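/- A \emph{graph structure} on a group $G$ is a finite directed graph $\Gamma$ (multiple edges allowed) with a distinguished initial vertex $v_0$ from which every vertex can be reached by a directed path, whose edges are labelled by elements of $G$ so that distinct edges going out of the same vertex have distinct labels. A finite directed path (possibly empty) is evaluated to the product of its edge labels in order. $\Gamma$ is a \emph{geodesic combing of $G$ with respect to $S\subseteq G$} if $S$ is the set of all edge labels, evaluation is a bijection from the set of finite directed paths starting at $v_0$ onto $G$, and for every finite directed path $p$ the word length of its value with respect to $S$ equals the length of $p$. $\Gamma$ is \emph{recurrent} if every vertex admits a directed path to every vertex other than $v_0$. Let $\Lambda$ be a finite simplicial graph with at least two vertices which is anticonnected, i.e. its complement graph is connected. For each vertex $x$ of $\Lambda$ let $G_x$ be a nontrivial group with a geodesic combing $\Gamma_x$ with respect to $S_x \subseteq G_x$. Let $G(\Lambda)$ be the graph product, i.e. the quotient of the free product of the groups $G_x$ by the relations $[g,h]=1$ for all $g\in G_x$, $h\in G_y$ with $x,y$ adjacent in $\Lambda$. Then there is a geodesic combing of $G(\Lambda)$ with respect to the (image in $G(\Lambda)$ of the) set $\bigcup_x S_x$ which is recurrent. -/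

import Mathlib

/-- The relators of a graph product: the commutators of elements of adjacent vertex groups. -/
def graphProductRelators {V : Type*} (Λ : SimpleGraph V) (G : V → Type*) [∀ x, Group (G x)] :
    Set (Monoid.CoprodI G) :=
  {c | ∃ (x y : V) (g : G x) (h : G y), Λ.Adj x y ∧
    c = Monoid.CoprodI.of g * Monoid.CoprodI.of h *
      (Monoid.CoprodI.of g)⁻¹ * (Monoid.CoprodI.of h)⁻¹}

/-- The graph product `G(Λ)` of the groups `G x` along the simplicial graph `Λ`: the free product
of the vertex groups modulo the relations saying that `G x` and `G y` commute whenever `x` and `y`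
are adjacent in `Λ`. -/
def GraphProduct {V : Type*} (Λ : SimpleGraph V) (G : V → Type*) [∀ x, Group (G x)] : Type _ :=
  Monoid.CoprodI G ⧸ Subgroup.normalClosure (graphProductRelators Λ G)

namespace GraphProduct

instance instGroup {V : Type*} (Λ : SimpleGraph V) (G : V → Type*) [∀ x, Group (G x)] :
    Group (GraphProduct Λ G) :=
  inferInstanceAs (Group (Monoid.CoprodI G ⧸ Subgroup.normalClosure (graphProductRelators Λ G)))

/-- The canonical homomorphism from a vertex group to the graph product. -/
def of {V : Type*} (Λ : SimpleGraph V) (G : V → Type*) [∀ x, Group (G x)] (x : V) :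
    G x →* GraphProduct Λ G :=
  (QuotientGroup.mk' (Subgroup.normalClosure (graphProductRelators Λ G))).comp Monoid.CoprodI.of

end GraphProduct

/-- The word length of `g` with respect to `S`: the least length of a word in the letters
`S ∪ S⁻¹` with product `g`, that is, the distance from `1` to `g` in the Cayley graph of `S`.
(It has the junk value `0` if `g` does not lie in the subgroup generated by `S`.) -/
noncomputable def wordLength {G : Type*} [Group G] (S : Set G) (g : G) : ℕ :=
  sInf {n : ℕ | ∃ l : List G, (∀ s ∈ l, s ∈ S ∨ s⁻¹ ∈ S) ∧ l.prod = g ∧ l.length = n}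

/-- A graph structure on a group `G`: a finite directed graph (loops and multiple edges are
allowed) with an initial vertex from which every vertex can be reached by a directed path, and
with edges labelled by elements of `G` such that distinct edges out of the same vertex have
distinct labels. As the graph is finite, taking vertices and edges in `Type` loses nothing. -/
structure GraphStructure (G : Type*) where
  /-- the vertices -/
  Vert : Type
  /-- the edges from one vertex to another -/
  Edge : Vert → Vert → Type
  finite_vert : Finite Vert
  finite_edge : ∀ v w, Finite (Edge v w)
  /-- the initial vertex -/
  init : Vert
  /-- the labels of the edges -/
  label : ∀ {v w : Vert}, Edge v w → G
  label_injective : ∀ v : Vert, Function.Injective fun e : Σ w, Edge v w => label e.2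
  reachable : ∀ v : Vert, Nonempty (@Quiver.Path Vert ⟨Edge⟩ init v)

namespace GraphStructure

instance instQuiver {G : Type*} (Γ : GraphStructure G) : Quiver Γ.Vert := ⟨Γ.Edge⟩

/-- The set `S = ev (E(Γ))` of all edge labels. -/
def labels {G : Type*} (Γ : GraphStructure G) : Set G :=
  {s | ∃ (v w : Γ.Vert) (e : Γ.Edge v w), Γ.label e = s}

/-- The evaluation map on finite directed paths: the product of the edge labels, in order. -/
def ev {G : Type*} [Group G] (Γ : GraphStructure G) {v w : Γ.Vert} (p : Quiver.Path v w) : G :=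
  p.weight fun {_ _} e => Γ.label e

/-- `Γ` is a geodesic combing of `G` with respect to `S`: the set of edge labels is `S`,
evaluation is a bijection from the set of finite paths starting at the initial vertex (the empty
path included) to `G`, and the length of every finite path is the word length of its value. -/
structure IsGeodesicCombing {G : Type*} [Group G] (Γ : GraphStructure G) (S : Set G) : Prop where
  labels_eq : Γ.labels = S
  bijective : Function.Bijective fun p : Σ v : Γ.Vert, Quiver.Path Γ.init v => Γ.ev p.2
  geodesic : ∀ (v w : Γ.Vert) (p : Quiver.Path v w), wordLength S (Γ.ev p) = p.length

/-- A graph structure is recurrent if every vertex admits a directed path to every vertex other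
than the initial one. -/
def IsRecurrent {G : Type*} (Γ : GraphStructure G) : Prop :=
  ∀ v w : Γ.Vert, w ≠ Γ.init → Nonempty (Quiver.Path v w)

end GraphStructure

/-! Fix a linear order on the vertices. An element of the graph product is a word of syllables, i.e.
of nontrivial elements of vertex groups. It is put in normal form by deleting trivial syllables,
merging two syllables at one vertex when everything between them commutes with that vertex, and
moving smaller vertices to the left across adjacent larger ones. Normality can be checked by
remembering only the finite set of vertices that may not come next (`nfStep`). Spelling every
syllable by its word in the combing of its vertex group turns this into a finite deterministic
automaton over the union of the generating sets (`CombStep`).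

Normal forms are unique because the graph product acts on reduced traces, and a normal form sends
the empty trace to its own trace, from which it can be read off (`traceAct_value`,
`eq_of_trace_eq`). The spellings are geodesic because normalization never increases the total length
of the syllables (`exists_normalForm`): a shortest word over the generators normalizes to the same
normal form.

Recurrence depends on the choice of order. Vertices are ordered by distance, in the complement
graph, from a root `m`, so each other vertex has a smaller vertex not adjacent to it in `Λ`
(`exists_linearOrder`). Moves along edges of the complement are always allowed, and each forgets the
vertex it moves to a non-neighbour of. Thus the largest forbidden vertex can be removed again and
again until only `m` is forbidden (`Leads.clear`). From there every state that follows a first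
syllable can be reached, and so can everything after it. -/

/-! ### Runs of automata and word length -/

/-- `Run δ q l q'` holds if the automaton with transition relation `δ` can go from the state `q`
to the state `q'` while reading the word `l`. -/
def Run {Q α : Type*} (δ : Q → α → Q → Prop) : Q → List α → Q → Prop
  | q, [], q' => q = q'
  | q, a :: l, q' => ∃ r, δ q a r ∧ Run δ r l q'

namespace Run

variable {Q α : Type*} {δ : Q → α → Q → Prop}

theorem append_iff {q q' : Q} {l l' : List α} :
    Run δ q (l ++ l') q' ↔ ∃ r, Run δ q l r ∧ Run δ r l' q' := by
  induction l generalizing q with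
  | nil => simp [Run]
  | cons a l ih =>
    simp only [List.cons_append, Run, ih]
    constructor
    · rintro ⟨r, h, r', h', h''⟩
      exact ⟨r', ⟨r, h, h'⟩, h''⟩
    · rintro ⟨r', ⟨r, h, h'⟩, h''⟩
      exact ⟨r, h, r', h', h''⟩

theorem singleton_iff {q q' : Q} {a : α} : Run δ q [a] q' ↔ δ q a q' := by
  simp [Run]

theorem concat_iff {q q' : Q} {l : List α} {a : α} :
    Run δ q (l ++ [a]) q' ↔ ∃ r, Run δ q l r ∧ δ r a q' := by
  simp [append_iff, singleton_iff]

theorem trans {q r q' : Q} {l l' : List α} (h : Run δ q l r) (h' : Run δ r l' q') :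
    Run δ q (l ++ l') q' :=
  append_iff.2 ⟨r, h, h'⟩

theorem mem {P : α → Prop} (hP : ∀ q a r, δ q a r → P a) {q q' : Q} {l : List α}
    (h : Run δ q l q') : ∀ a ∈ l, P a := by
  induction l generalizing q with
  | nil => simp
  | cons b l ih =>
    obtain ⟨r, hr, h⟩ := h
    simpa using ⟨hP _ _ _ hr, ih h⟩

end Run

theorem wordLength_le {G : Type*} [Group G] {S : Set G} {l : List G}
    (hl : ∀ s ∈ l, s ∈ S ∨ s⁻¹ ∈ S) : wordLength S l.prod ≤ l.length :=
  Nat.sInf_le ⟨l, hl, rfl, rfl⟩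

/-- Speaking of the product of a given word over the generators makes the infimum an attained
minimum, so the junk value `0` is excluded. -/
theorem exists_list_of_wordLength {G : Type*} [Group G] {S : Set G} {l : List G}
    (hl : ∀ s ∈ l, s ∈ S ∨ s⁻¹ ∈ S) :
    ∃ l' : List G, (∀ s ∈ l', s ∈ S ∨ s⁻¹ ∈ S) ∧ l'.prod = l.prod ∧
      l'.length = wordLength S l.prod :=
  Nat.sInf_mem (s := {n : ℕ | ∃ l' : List G, (∀ s ∈ l', s ∈ S ∨ s⁻¹ ∈ S) ∧ l'.prod = l.prod ∧
    l'.length = n}) ⟨l.length, l, hl, rfl, rfl⟩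

theorem wordLength_one {G : Type*} [Group G] (S : Set G) : wordLength S (1 : G) = 0 := by
  simpa using wordLength_le (S := S) (l := []) (by simp)

theorem wordLength_le_one {G : Type*} [Group G] {S : Set G} {s : G} (hs : s ∈ S ∨ s⁻¹ ∈ S) :
    wordLength S s ≤ 1 := by
  simpa using wordLength_le (S := S) (l := [s]) (by simpa using hs)

/-! ### Paths in a graph structure as runs, and consequences of being a geodesic combing -/

namespace GraphStructure

variable {G : Type*}

/-- The transition relation of a graph structure. -/
def Step (Γ : GraphStructure G) (v : Γ.Vert) (s : G) (w : Γ.Vert) : Prop :=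
  ∃ e : Γ.Edge v w, Γ.label e = s

/-- The list of edge labels of a path. -/
def word (Γ : GraphStructure G) {v : Γ.Vert} : ∀ {w : Γ.Vert}, Quiver.Path v w → List G
  | _, .nil => []
  | _, .cons p e => Γ.word p ++ [Γ.label e]

theorem length_word (Γ : GraphStructure G) {v w : Γ.Vert} (p : Quiver.Path v w) :
    (Γ.word p).length = p.length := by
  induction p with
  | nil => rfl
  | cons p e ih => simp [word, ih]

theorem prod_word [Group G] (Γ : GraphStructure G) {v w : Γ.Vert} (p : Quiver.Path v w) :
    (Γ.word p).prod = Γ.ev p := by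
  induction p with
  | nil => simp [word, ev]
  | cons p e ih =>
    rw [word, List.prod_append, ih]
    simp [ev, Quiver.Path.weight_cons]

theorem run_word (Γ : GraphStructure G) {v w : Γ.Vert} (p : Quiver.Path v w) :
    Run Γ.Step v (Γ.word p) w := by
  induction p with
  | nil => rfl
  | cons p e ih => exact Run.concat_iff.2 ⟨_, ih, e, rfl⟩

theorem exists_path_of_run (Γ : GraphStructure G) {v w : Γ.Vert} {l : List G}
    (h : Run Γ.Step v l w) : ∃ p : Quiver.Path v w, Γ.word p = l := by
  induction l using List.reverseRecOn generalizing w with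
  | nil => cases h; exact ⟨.nil, rfl⟩
  | append_singleton l a ih =>
    obtain ⟨r, hr, e, he⟩ := Run.concat_iff.1 h
    obtain ⟨p, rfl⟩ := ih hr
    exact ⟨p.cons e, by rw [word, he]⟩

theorem path_eq_of_word_eq (Γ : GraphStructure G) {v w w' : Γ.Vert} (p : Quiver.Path v w)
    (p' : Quiver.Path v w') (h : Γ.word p = Γ.word p') :
    (⟨w, p⟩ : Σ w, Quiver.Path v w) = ⟨w', p'⟩ := by
  induction p generalizing w' with
  | nil =>
    cases p' with
    | nil => rfl
    | cons p' e' => simp [word] at h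
  | cons p e ih =>
    cases p' with
    | nil => simp [word] at h
    | cons p' e' =>
      simp only [word] at h
      obtain ⟨h₁, h₂⟩ := List.append_inj' h rfl
      have := ih p' h₁
      cases this
      have h₃ := @Γ.label_injective _ ⟨_, e⟩ ⟨_, e'⟩ (by simpa using h₂)
      cases h₃
      rfl

theorem Step.unique {Γ : GraphStructure G} {v w w' : Γ.Vert} {s : G} (h : Γ.Step v s w)
    (h' : Γ.Step v s w') : w = w' := by
  obtain ⟨e, rfl⟩ := h
  obtain ⟨e', he⟩ := h'
  have h₃ := @Γ.label_injective _ ⟨_, e'⟩ ⟨_, e⟩ he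
  cases h₃
  rfl

namespace IsGeodesicCombing

variable [Group G] {Γ : GraphStructure G} {S : Set G}

theorem exists_run (h : Γ.IsGeodesicCombing S) (g : G) :
    ∃ l v, Run Γ.Step Γ.init l v ∧ l.prod = g := by
  obtain ⟨⟨v, p⟩, hp⟩ := h.bijective.2 g
  exact ⟨Γ.word p, v, Γ.run_word p, by rw [prod_word]; exact hp⟩

theorem run_unique (h : Γ.IsGeodesicCombing S) {l l' : List G} {v v' : Γ.Vert}
    (hl : Run Γ.Step Γ.init l v) (hl' : Run Γ.Step Γ.init l' v') (heq : l.prod = l'.prod) :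
    l = l' := by
  obtain ⟨p, rfl⟩ := Γ.exists_path_of_run hl
  obtain ⟨p', rfl⟩ := Γ.exists_path_of_run hl'
  rw [prod_word, prod_word] at heq
  have := @h.bijective.1 ⟨_, p⟩ ⟨_, p'⟩ heq
  cases this
  rfl

theorem run_length (h : Γ.IsGeodesicCombing S) {l : List G} {v w : Γ.Vert}
    (hl : Run Γ.Step v l w) : wordLength S l.prod = l.length := by
  obtain ⟨p, rfl⟩ := Γ.exists_path_of_run hl
  rw [prod_word, length_word]
  exact h.geodesic _ _ p

theorem prod_ne_one (h : Γ.IsGeodesicCombing S) {v w : Γ.Vert} {l : List G}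
    (hl : Run Γ.Step v l w) (hne : l ≠ []) : l.prod ≠ 1 := by
  intro h1
  have := h.run_length hl
  rw [h1, wordLength_one] at this
  exact hne (List.length_eq_zero_iff.1 this.symm)

theorem step_mem (h : Γ.IsGeodesicCombing S) {v w : Γ.Vert} {s : G} (hs : Γ.Step v s w) :
    s ∈ S := by
  obtain ⟨e, rfl⟩ := hs
  rw [← h.labels_eq]
  exact ⟨v, w, e, rfl⟩

theorem wordLength_of_mem (h : Γ.IsGeodesicCombing S) {s : G} (hs : s ∈ S) :
    wordLength S s = 1 := by
  rw [← h.labels_eq] at hs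
  obtain ⟨v, w, e, rfl⟩ := hs
  simpa using h.run_length (Run.singleton_iff.2 ⟨e, rfl⟩)

theorem ne_one_of_mem (h : Γ.IsGeodesicCombing S) {s : G} (hs : s ∈ S) : s ≠ 1 := by
  rintro rfl
  simpa [wordLength_one] using h.wordLength_of_mem hs

/-- A generator has word length 1, so the path from the initial vertex that represents it is a
single edge. -/
theorem exists_step_of_mem (h : Γ.IsGeodesicCombing S) {s : G} (hs : s ∈ S) :
    ∃ v, Γ.Step Γ.init s v := by
  obtain ⟨l, v, hl, rfl⟩ := h.exists_run s
  have h1 := h.run_length hl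
  rw [h.wordLength_of_mem hs] at h1
  obtain ⟨a, rfl⟩ := List.length_eq_one_iff.1 h1.symm
  exact ⟨v, by simpa using Run.singleton_iff.1 hl⟩

theorem exists_list (h : Γ.IsGeodesicCombing S) (g : G) :
    ∃ l : List G, (∀ s ∈ l, s ∈ S ∨ s⁻¹ ∈ S) ∧ l.prod = g ∧ l.length = wordLength S g := by
  obtain ⟨l, v, hl, rfl⟩ := h.exists_run g
  exact ⟨l, fun s hs => Or.inl (hl.mem (P := (· ∈ S)) (fun _ _ _ hs => h.step_mem hs) s hs), rfl,
    (h.run_length hl).symm⟩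

theorem wordLength_mul_le (h : Γ.IsGeodesicCombing S) (a b : G) :
    wordLength S (a * b) ≤ wordLength S a + wordLength S b := by
  obtain ⟨l, hl, rfl, hla⟩ := h.exists_list a
  obtain ⟨l', hl', rfl, hlb⟩ := h.exists_list b
  rw [← hla, ← hlb, ← List.prod_append, ← List.length_append]
  apply wordLength_le
  intro s hs
  rcases List.mem_append.1 hs with hs | hs
  exacts [hl s hs, hl' s hs]

theorem finite (h : Γ.IsGeodesicCombing S) : S.Finite := by
  have := Γ.finite_vert
  have := Γ.finite_edge
  rw [← h.labels_eq]
  have : Γ.labels = Set.range fun e : Σ v w, Γ.Edge v w => Γ.label e.2.2 := by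
    ext s
    constructor
    · rintro ⟨v, w, e, rfl⟩
      exact ⟨⟨v, w, e⟩, rfl⟩
    · rintro ⟨⟨v, w, e⟩, rfl⟩
      exact ⟨v, w, e, rfl⟩
  rw [this]
  exact Set.finite_range _

end IsGeodesicCombing

/-! ### From a deterministic finite automaton to a graph structure -/

section OfAutomaton

variable {Q : Type*} {δ : Q → G → Q → Prop} {q₀ : Q} {S : Set G} {n m : ℕ}

/-- The quiver of the reachable states of an automaton, with states and letters enumerated. -/
abbrev autEdge (e : Fin n ≃ {q // ∃ l, Run δ q₀ l q}) (c : Fin m ≃ S) (i j : Fin n) : Type :=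
  {k : Fin m // δ (e i) (c k) (e j)}

theorem autEdge_exists_path (hlab : ∀ q s r, δ q s r → s ∈ S)
    (e : Fin n ≃ {q // ∃ l, Run δ q₀ l q}) (c : Fin m ≃ S) {i : Fin n} {q : Q} {l : List G}
    (h : Run δ (e i) l q) :
    ∃ j, (e j : Q) = q ∧ Nonempty (@Quiver.Path (Fin n) ⟨autEdge e c⟩ i j) := by
  induction l using List.reverseRecOn generalizing q with
  | nil => exact ⟨i, h, ⟨@Quiver.Path.nil _ ⟨autEdge e c⟩ i⟩⟩
  | append_singleton l a ih =>
    obtain ⟨r, hr, ha⟩ := Run.concat_iff.1 h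
    obtain ⟨j, rfl, ⟨p⟩⟩ := ih hr
    obtain ⟨l', hl'⟩ := (e j).2
    have hc := c.apply_symm_apply ⟨a, hlab _ _ _ ha⟩
    have he := e.apply_symm_apply ⟨q, l' ++ [a], Run.concat_iff.2 ⟨_, hl', ha⟩⟩
    refine ⟨e.symm ⟨q, l' ++ [a], Run.concat_iff.2 ⟨_, hl', ha⟩⟩, by rw [he], ⟨?_⟩⟩
    refine @Quiver.Path.cons _ ⟨autEdge e c⟩ _ _ _ p ⟨c.symm ⟨a, hlab _ _ _ ha⟩, ?_⟩
    rw [hc, he]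
    exact ha

/-- The graph structure given by a deterministic finite automaton. -/
def ofAutomaton (hdet : ∀ q s r r', δ q s r → δ q s r' → r = r')
    (hlab : ∀ q s r, δ q s r → s ∈ S)
    (e : Fin n ≃ {q // ∃ l, Run δ q₀ l q}) (c : Fin m ≃ S) : GraphStructure G where
  Vert := Fin n
  Edge := autEdge e c
  finite_vert := inferInstance
  finite_edge _ _ := inferInstance
  init := e.symm ⟨q₀, [], rfl⟩
  label k := c k.1
  label_injective := by
    rintro v ⟨w, k, hk⟩ ⟨w', k', hk'⟩ h
    have : k = k' := c.injective (Subtype.ext h)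
    subst this
    have : w = w' := e.injective (Subtype.ext (hdet _ _ _ _ hk hk'))
    subst this
    rfl
  reachable v := by
    obtain ⟨l, hl⟩ := (e v).2
    have he : ((e (e.symm ⟨q₀, [], rfl⟩)) : Q) = q₀ := by rw [e.apply_symm_apply]
    obtain ⟨j, hj, hp⟩ := autEdge_exists_path hlab e c (i := e.symm ⟨q₀, [], rfl⟩)
      (q := e v) (l := l) (by rw [he]; exact hl)
    have : j = v := e.injective (Subtype.ext hj)
    exact this ▸ hp

/-- Restricting to reachable states allows uniqueness, geodesicity and recurrence to be assumed only
for runs from `q₀`. The states and letters are numbered because they may live in any universe, while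
vertices and edges must be in `Type`. -/
theorem exists_combing_of_automaton [Group G] [Finite Q] (hS : S.Finite)
    (hdet : ∀ q s r r', δ q s r → δ q s r' → r = r')
    (hlab : ∀ q s r, δ q s r → s ∈ S)
    (hinit : ∀ s ∈ S, ∃ q, δ q₀ s q)
    (hex : ∀ g : G, ∃ l q, Run δ q₀ l q ∧ l.prod = g)
    (huniq : ∀ l l' q q', Run δ q₀ l q → Run δ q₀ l' q' → l.prod = l'.prod → l = l')
    (hgeo : ∀ l q, Run δ q₀ l q → wordLength S l.prod = l.length)
    (hrec : ∀ q q', (∃ l, Run δ q₀ l q) → (∃ l, Run δ q₀ l q') → q' ≠ q₀ → ∃ l, Run δ q l q') :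
    ∃ Δ : GraphStructure G, Δ.IsGeodesicCombing S ∧ Δ.IsRecurrent := by
  obtain ⟨n, ⟨e⟩⟩ := Finite.exists_equiv_fin {q // ∃ l, Run δ q₀ l q}
  have : Finite S := hS
  obtain ⟨m, ⟨c⟩⟩ := Finite.exists_equiv_fin S
  let Δ := ofAutomaton hdet hlab e.symm c.symm
  let f : Δ.Vert → Q := fun v => (e.symm v : Q)
  have hf : ∀ v, ∃ l, Run δ q₀ l (f v) := fun v => (e.symm v).2
  have hfinj : Function.Injective f := Subtype.val_injective.comp e.symm.injective
  have hf0 : f Δ.init = q₀ := by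
    change ((e.symm (e.symm.symm ⟨q₀, [], rfl⟩)) : Q) = q₀
    rw [Equiv.apply_symm_apply]
  have hstep : ∀ v s w, Δ.Step v s w ↔ δ (f v) s (f w) := by
    intro v s w
    constructor
    · rintro ⟨⟨k, hk⟩, rfl⟩
      exact hk
    · intro h
      have hc := c.symm.apply_symm_apply ⟨s, hlab _ _ _ h⟩
      refine ⟨⟨c.symm.symm ⟨s, hlab _ _ _ h⟩, ?_⟩, ?_⟩
      · rw [hc]
        exact h
      · change (c.symm (c.symm.symm ⟨s, _⟩) : G) = s
        rw [hc]
  have hrun : ∀ l v w, Run Δ.Step v l w → Run δ (f v) l (f w) := by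
    intro l
    induction l with
    | nil => intro v w h; cases h; rfl
    | cons a l ih =>
      rintro v w ⟨r, hr, h⟩
      exact ⟨f r, (hstep _ _ _).1 hr, ih _ _ h⟩
  have hrun' : ∀ l v q, Run δ (f v) l q → ∃ w, f w = q ∧ Run Δ.Step v l w := by
    intro l
    induction l using List.reverseRecOn with
    | nil => intro v q h; exact ⟨v, h, rfl⟩
    | append_singleton l a ih =>
      intro v q h
      obtain ⟨r, hr, h⟩ := Run.concat_iff.1 h
      obtain ⟨u, rfl, hu⟩ := ih v r hr
      obtain ⟨l', hl'⟩ := hf u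
      have hq : f (e ⟨q, l' ++ [a], Run.concat_iff.2 ⟨_, hl', h⟩⟩) = q := by
        change ((e.symm (e _)) : Q) = q
        rw [Equiv.symm_apply_apply]
      refine ⟨_, hq, Run.concat_iff.2 ⟨u, hu, (hstep _ _ _).2 ?_⟩⟩
      rw [hq]
      exact h
  have hmem : ∀ {v w l}, Run Δ.Step v l w → ∀ s ∈ l, s ∈ S ∨ s⁻¹ ∈ S := fun h s hs =>
    Or.inl (h.mem (P := (· ∈ S)) (fun _ _ _ h => hlab _ _ _ ((hstep _ _ _).1 h)) s hs)
  refine ⟨Δ, ⟨?_, ⟨?_, ?_⟩, ?_⟩, ?_⟩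
  · ext s
    constructor
    · rintro ⟨v, w, k, rfl⟩
      exact hlab _ _ _ ((hstep v _ w).1 ⟨k, rfl⟩)
    · intro hs
      obtain ⟨q, hq⟩ := hinit s hs
      rw [← hf0] at hq
      obtain ⟨w, rfl, hw⟩ := hrun' [s] _ q (Run.singleton_iff.2 hq)
      obtain ⟨k, hk⟩ := Run.singleton_iff.1 hw
      exact ⟨_, _, k, hk⟩
  · rintro ⟨v, p⟩ ⟨v', p'⟩ h
    apply Δ.path_eq_of_word_eq
    have h₁ := hrun _ _ _ (Δ.run_word p)
    have h₂ := hrun _ _ _ (Δ.run_word p')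
    rw [hf0] at h₁ h₂
    exact huniq _ _ _ _ h₁ h₂ (by rw [prod_word, prod_word]; exact h)
  · intro g
    obtain ⟨l, q, hl, rfl⟩ := hex g
    rw [← hf0] at hl
    obtain ⟨w, -, hw⟩ := hrun' _ _ _ hl
    obtain ⟨p, rfl⟩ := Δ.exists_path_of_run hw
    exact ⟨⟨w, p⟩, (Δ.prod_word p).symm⟩
  · intro v w p
    -- Geodesicity is assumed only from the initial state: prepend a path `p₀` from there to `v`. A
    -- shorter word for the value of `p` would shorten the concatenation.
    obtain ⟨p₀⟩ := Δ.reachable v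
    have h₀ := Δ.run_word (show Quiver.Path Δ.init v from p₀)
    have h₁ := Δ.run_word p
    have h₂ := hrun _ _ _ (h₀.trans h₁)
    rw [hf0] at h₂
    have h₃ := hgeo _ _ h₂
    obtain ⟨l, hl, hlp, hll⟩ := exists_list_of_wordLength (hmem h₁)
    have h₄ := wordLength_le (S := S) (l := Δ.word (show Quiver.Path Δ.init v from p₀) ++ l) (by
      intro s hs
      rcases List.mem_append.1 hs with hs | hs
      exacts [hmem h₀ s hs, hl s hs])
    rw [List.prod_append, hlp, ← List.prod_append, h₃] at h₄
    have h₅ := wordLength_le (hmem h₁)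
    simp only [List.length_append] at h₄
    rw [← prod_word, ← length_word]
    omega
  · intro v w hw
    obtain ⟨l, hl⟩ := hrec (f v) (f w) (hf v) (hf w) (fun h => hw (hfinj (h.trans hf0.symm)))
    obtain ⟨u, hu, hr⟩ := hrun' _ _ _ hl
    have := hfinj hu
    subst this
    obtain ⟨p, -⟩ := Δ.exists_path_of_run hr
    exact ⟨p⟩

end OfAutomaton

end GraphStructure

/-! ### Traces: words up to commutation -/

namespace GraphProduct

variable {V : Type*} (Λ : SimpleGraph V) (G : V → Type*)

/-- Families of words indexed by the pairs of non-adjacent vertices. A word in the vertex groups is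
encoded, up to swapping neighbouring syllables from adjacent vertices, by the family of its
projections to the pairs of non-adjacent vertices. -/
abbrev TraceFamily : Type _ := {p : V × V // ¬ Λ.Adj p.1 p.2} → List (Σ x, G x)

variable {Λ G}

open Classical in
/-- Put a syllable in front of a trace. -/
noncomputable def push (a : Σ x, G x) (T : TraceFamily Λ G) : TraceFamily Λ G := fun p =>
  if p.1.1 = a.1 ∨ p.1.2 = a.1 then a :: T p else T p

theorem push_of_mem {a : Σ x, G x} {T : TraceFamily Λ G} {p : {p : V × V // ¬ Λ.Adj p.1 p.2}}
    (h : p.1.1 = a.1 ∨ p.1.2 = a.1) : push a T p = a :: T p := if_pos h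

theorem push_of_notMem {a : Σ x, G x} {T : TraceFamily Λ G}
    {p : {p : V × V // ¬ Λ.Adj p.1 p.2}} (h : ¬ (p.1.1 = a.1 ∨ p.1.2 = a.1)) :
    push a T p = T p := if_neg h

/-- The trace `T` starts with the syllable `a`. -/
def FrontedBy (a : Σ x, G x) (T : TraceFamily Λ G) : Prop :=
  ∀ p : {p : V × V // ¬ Λ.Adj p.1 p.2}, (p.1.1 = a.1 ∨ p.1.2 = a.1) → ∃ t, T p = a :: t

/-- The trace `T` does not start with a syllable of the vertex `x`. -/
def Free (x : V) (T : TraceFamily Λ G) : Prop := ∀ g : G x, ¬ FrontedBy ⟨x, g⟩ T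

/-- The index pairs are non-adjacent, so none of them sees two adjacent vertices. This is why
commuting syllables do not interact in a trace. -/
theorem notMem_of_adj {x y : V} (h : Λ.Adj x y) {p : {p : V × V // ¬ Λ.Adj p.1 p.2}}
    (hp : p.1.1 = x ∨ p.1.2 = x) : ¬ (p.1.1 = y ∨ p.1.2 = y) := by
  obtain ⟨⟨u, v⟩, hn⟩ := p
  have hne := h.ne
  rintro (h' | h') <;> rcases hp with hp | hp <;> simp only at h' hp hn <;> subst hp <;> subst h'
  · exact hne rfl
  · exact hn h.symm
  · exact hn h
  · exact hne rfl

/-- The diagonal pair of the vertex, which is non-adjacent to itself, records the syllables at that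
vertex in order. -/
theorem FrontedBy.eq {a b : Σ x, G x} {T : TraceFamily Λ G} (ha : FrontedBy a T)
    (hb : FrontedBy b T) (h : a.1 = b.1) : a = b := by
  obtain ⟨t, ht⟩ := ha ⟨(a.1, a.1), Λ.irrefl⟩ (Or.inl rfl)
  obtain ⟨t', ht'⟩ := hb ⟨(a.1, a.1), Λ.irrefl⟩ (Or.inl h)
  rw [ht] at ht'
  exact (List.cons.inj ht').1

theorem frontedBy_push_self (a : Σ x, G x) (T : TraceFamily Λ G) : FrontedBy a (push a T) :=
  fun p hp => ⟨T p, push_of_mem hp⟩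

/-- If the two vertices were not adjacent, the coordinate of their pair would start with `b`, hence
not with `a`. -/
theorem frontedBy_push_iff {a b : Σ x, G x} {T : TraceFamily Λ G} (hab : a.1 ≠ b.1) :
    FrontedBy a (push b T) ↔ Λ.Adj a.1 b.1 ∧ FrontedBy a T := by
  constructor
  · intro h
    have hadj : Λ.Adj a.1 b.1 := by
      by_contra hn
      obtain ⟨t, ht⟩ := h ⟨(a.1, b.1), hn⟩ (Or.inl rfl)
      rw [push_of_mem (Or.inr rfl)] at ht
      exact hab (congrArg Sigma.fst (List.cons.inj ht).1.symm)
    refine ⟨hadj, fun p hp => ?_⟩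
    obtain ⟨t, ht⟩ := h p hp
    rw [push_of_notMem (notMem_of_adj hadj hp)] at ht
    exact ⟨t, ht⟩
  · rintro ⟨hadj, h⟩ p hp
    rw [push_of_notMem (notMem_of_adj hadj hp)]
    exact h p hp

theorem free_push_iff {x : V} {b : Σ x, G x} {T : TraceFamily Λ G} (h : Λ.Adj x b.1) :
    Free x (push b T) ↔ Free x T :=
  forall_congr' fun g => not_congr <| by
    rw [frontedBy_push_iff (a := ⟨x, g⟩) h.ne]
    exact and_iff_right h

theorem push_comm {a b : Σ x, G x} (h : Λ.Adj a.1 b.1) (T : TraceFamily Λ G) :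
    push a (push b T) = push b (push a T) := by
  funext p
  by_cases ha : p.1.1 = a.1 ∨ p.1.2 = a.1
  · have hb := notMem_of_adj h ha
    rw [push_of_mem ha, push_of_notMem hb, push_of_notMem hb, push_of_mem ha]
  · by_cases hb : p.1.1 = b.1 ∨ p.1.2 = b.1
    · rw [push_of_notMem ha, push_of_mem hb, push_of_mem hb, push_of_notMem ha]
    · rw [push_of_notMem ha, push_of_notMem hb, push_of_notMem hb, push_of_notMem ha]

theorem push_injective (a : Σ x, G x) :
    Function.Injective (push a : TraceFamily Λ G → TraceFamily Λ G) := by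
  intro T T' h
  funext p
  have hp := congrFun h p
  by_cases ha : p.1.1 = a.1 ∨ p.1.2 = a.1
  · rw [push_of_mem ha, push_of_mem ha] at hp
    exact (List.cons.inj hp).2
  · rwa [push_of_notMem ha, push_of_notMem ha] at hp

theorem not_frontedBy_nil (a : Σ x, G x) : ¬ FrontedBy a (fun _ => [] : TraceFamily Λ G) := by
  intro h
  obtain ⟨t, ht⟩ := h ⟨(a.1, a.1), Λ.irrefl⟩ (Or.inl rfl)
  simp at ht

/-! ### Reduced traces and the action of the graph product -/

variable [∀ x, Group (G x)]

/-- The traces of reduced words. -/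
inductive Reduced : TraceFamily Λ G → Prop
  | nil : Reduced fun _ => []
  | push (a : Σ x, G x) (T : TraceFamily Λ G) : Reduced T → a.2 ≠ 1 → Free a.1 T →
      Reduced (push a T)

/-- A syllable that can be brought to the front commutes with every syllable pushed after it, so it
can be taken out with those pushes kept in place. -/
theorem Reduced.exists_eq_push {T : TraceFamily Λ G} (hT : Reduced T) {a : Σ x, G x}
    (h : FrontedBy a T) : ∃ T', Reduced T' ∧ Free a.1 T' ∧ a.2 ≠ 1 ∧
      T = GraphProduct.push a T' := by
  induction hT with
  | nil => exact absurd h (not_frontedBy_nil a)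
  | push b T hT hb hf ih =>
    by_cases hab : a.1 = b.1
    · obtain rfl := h.eq (frontedBy_push_self b T) hab
      exact ⟨T, hT, hf, hb, rfl⟩
    · obtain ⟨hadj, h'⟩ := (frontedBy_push_iff hab).1 h
      obtain ⟨T', hT', hf', ha, rfl⟩ := ih h'
      exact ⟨_, .push b T' hT' hb ((free_push_iff hadj.symm).1 hf), (free_push_iff hadj).2 hf', ha,
        push_comm hadj.symm T'⟩

open Classical in
/-- Put a possibly trivial element of a vertex group in front of a trace. -/
noncomputable def place (x : V) (k : G x) (T : TraceFamily Λ G) : TraceFamily Λ G :=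
  if k = 1 then T else push ⟨x, k⟩ T

theorem place_one (x : V) (T : TraceFamily Λ G) : place x 1 T = T := if_pos rfl

theorem place_of_ne {x : V} {k : G x} (hk : k ≠ 1) (T : TraceFamily Λ G) :
    place x k T = push ⟨x, k⟩ T := if_neg hk

theorem Reduced.place {x : V} {T : TraceFamily Λ G} (hT : Reduced T) (hx : Free x T) (k : G x) :
    Reduced (place x k T) := by
  by_cases hk : k = 1
  · rwa [hk, place_one]
  · rw [place_of_ne hk]
    exact .push _ _ hT hk hx

theorem Reduced.exists_eq_place {T : TraceFamily Λ G} (hT : Reduced T) (x : V) :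
    ∃ k T', Reduced T' ∧ Free x T' ∧ T = GraphProduct.place x k T' := by
  by_cases hx : Free x T
  · exact ⟨1, T, hT, hx, (place_one x T).symm⟩
  · simp only [Free, not_forall, not_not] at hx
    obtain ⟨k, hk⟩ := hx
    obtain ⟨T', hT', hf, hk', rfl⟩ := hT.exists_eq_push hk
    exact ⟨k, T', hT', hf, (place_of_ne hk' T').symm⟩

theorem place_inj {x : V} {k l : G x} {T T' : TraceFamily Λ G} (hT : Free x T) (hT' : Free x T')
    (h : place x k T = place x l T') : k = l ∧ T = T' := by
  by_cases hk : k = 1 <;> by_cases hl : l = 1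
  · subst hk hl
    exact ⟨rfl, by simpa only [place_one] using h⟩
  · subst hk
    rw [place_one, place_of_ne hl] at h
    exact absurd (h ▸ frontedBy_push_self _ _) (hT l)
  · subst hl
    rw [place_one, place_of_ne hk] at h
    exact absurd (h ▸ frontedBy_push_self _ _) (hT' k)
  · rw [place_of_ne hk, place_of_ne hl] at h
    have h₁ := frontedBy_push_self ⟨x, k⟩ T
    rw [h] at h₁
    have h₂ : (⟨x, k⟩ : Σ x, G x) = ⟨x, l⟩ := h₁.eq (frontedBy_push_self ⟨x, l⟩ T') rfl
    obtain rfl : k = l := by simpa using h₂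
    exact ⟨rfl, push_injective _ h⟩

theorem free_place_iff {x y : V} (h : Λ.Adj x y) {k : G y} {T : TraceFamily Λ G} :
    Free x (place y k T) ↔ Free x T := by
  by_cases hk : k = 1
  · rw [hk, place_one]
  · rw [place_of_ne hk, free_push_iff h]

theorem place_comm {x y : V} (h : Λ.Adj x y) (k : G x) (l : G y) (T : TraceFamily Λ G) :
    place x k (place y l T) = place y l (place x k T) := by
  by_cases hk : k = 1
  · subst hk
    simp only [place_one]
  by_cases hl : l = 1
  · subst hl
    simp only [place_one]
  rw [place_of_ne hk, place_of_ne hk, place_of_ne hl, place_of_ne hl]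
  exact push_comm h T

variable (Λ G) in
/-- The traces of reduced words. -/
abbrev ReducedTrace : Type _ := {T : TraceFamily Λ G // Reduced T}

variable (Λ G) in
/-- A reduced trace is uniquely an element of a given vertex group followed by a reduced trace that
does not start with a syllable of that vertex. -/
noncomputable def placeEquiv (x : V) :
    G x × {T : ReducedTrace Λ G // Free x T.1} ≃ ReducedTrace Λ G :=
  Equiv.ofBijective (fun q => ⟨place x q.1 q.2.1.1, q.2.1.2.place q.2.2 q.1⟩) <| by
    constructor
    · rintro ⟨k, ⟨T, hT⟩, hf⟩ ⟨k', ⟨T', hT'⟩, hf'⟩ h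
      obtain ⟨rfl, rfl⟩ := place_inj hf hf' (Subtype.ext_iff.1 h)
      rfl
    · rintro ⟨T, hT⟩
      obtain ⟨k, T', hT', hf, rfl⟩ := hT.exists_eq_place x
      exact ⟨⟨k, ⟨T', hT'⟩, hf⟩, rfl⟩

variable (Λ G) in
/-- The action of a vertex group on the reduced traces. -/
noncomputable def vertexAct (x : V) : G x →* Equiv.Perm (ReducedTrace Λ G) where
  toFun g := (placeEquiv Λ G x).permCongr ((Equiv.mulLeft g).prodCongr (Equiv.refl _))
  map_one' := by
    ext1 T
    simp [Equiv.permCongr_apply]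
  map_mul' g h := by
    ext1 T
    simp [Equiv.permCongr_apply, Function.comp_def, Prod.map_map]

theorem vertexAct_place {x : V} {T : TraceFamily Λ G} (hT : Reduced T) (hf : Free x T)
    (g k : G x) : vertexAct Λ G x g ⟨place x k T, hT.place hf k⟩ =
      ⟨place x (g * k) T, hT.place hf (g * k)⟩ := by
  have : (⟨place x k T, hT.place hf k⟩ : ReducedTrace Λ G) =
    placeEquiv Λ G x ⟨k, ⟨T, hT⟩, hf⟩ := rfl
  rw [this]
  simp only [vertexAct, MonoidHom.coe_mk, OneHom.coe_mk, Equiv.permCongr_apply,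
    Equiv.symm_apply_apply]
  rfl

theorem vertexAct_commute {x y : V} (h : Λ.Adj x y) (g : G x) (k : G y) :
    Commute (vertexAct Λ G x g) (vertexAct Λ G y k) := by
  -- Strip both an `x`-syllable and a `y`-syllable from the front. As they commute, each group
  -- multiplies its own syllable. The claim is made for general `x` and `y` because it is used in
  -- both orders.
  have key : ∀ {x y : V}, Λ.Adj x y → ∀ (g a : G x) (k b : G y) (T : TraceFamily Λ G)
      (hT : Reduced T) (hx : Free x T) (hy : Free y T)
      (h₁ : Reduced (place x a (place y b T))) (h₂ : Reduced (place x (g * a) (place y (k * b) T))),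
      vertexAct Λ G x g (vertexAct Λ G y k ⟨place x a (place y b T), h₁⟩) =
        ⟨place x (g * a) (place y (k * b) T), h₂⟩ := by
    intro x y h g a k b T hT hx hy h₁ h₂
    have e₁ : (⟨place x a (place y b T), h₁⟩ : ReducedTrace Λ G) =
        ⟨place y b (place x a T), (hT.place hx a).place ((free_place_iff h.symm).2 hy) b⟩ :=
      Subtype.ext (place_comm h a b T)
    rw [e₁, vertexAct_place (hT.place hx a) ((free_place_iff h.symm).2 hy)]
    have e₂ : (⟨place y (k * b) (place x a T),
        (hT.place hx a).place ((free_place_iff h.symm).2 hy) (k * b)⟩ : ReducedTrace Λ G) =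
        ⟨place x a (place y (k * b) T),
          (hT.place hy (k * b)).place ((free_place_iff h).2 hx) a⟩ :=
      Subtype.ext (place_comm h.symm (k * b) a T)
    rw [e₂, vertexAct_place (hT.place hy (k * b)) ((free_place_iff h).2 hx)]
  refine Equiv.ext fun ⟨T, hT⟩ => ?_
  obtain ⟨a, T', hT', hx, rfl⟩ := hT.exists_eq_place x
  obtain ⟨b, T, hT₀, hy, rfl⟩ := hT'.exists_eq_place y
  have hx' := (free_place_iff h).1 hx
  have hr : Reduced (place x (g * a) (place y (k * b) T)) :=
    (hT₀.place hy _).place ((free_place_iff h).2 hx') _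
  have hr' := place_comm h (g * a) (k * b) T ▸ hr
  have e₀ : (⟨place x a (place y b T), hT⟩ : ReducedTrace Λ G) =
    ⟨place y b (place x a T), place_comm h a b T ▸ hT⟩ := Subtype.ext (place_comm h a b T)
  rw [Equiv.Perm.mul_apply, Equiv.Perm.mul_apply, key h g a k b T hT₀ hx' hy hT hr, e₀,
    key h.symm k b g a T hT₀ hy hx' _ hr']
  exact Subtype.ext (place_comm h _ _ T)

variable (Λ G) in
/-- The action of a graph product on the reduced traces. -/
noncomputable def traceAct : GraphProduct Λ G →* Equiv.Perm (ReducedTrace Λ G) :=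
  QuotientGroup.lift _ (Monoid.CoprodI.lift (vertexAct Λ G)) <| by
    intro c hc
    refine Subgroup.normalClosure_le_normal (N := (Monoid.CoprodI.lift (vertexAct Λ G)).ker) ?_ hc
    rintro _ ⟨x, y, g, h, hadj, rfl⟩
    simp only [SetLike.mem_coe, MonoidHom.mem_ker, map_mul, map_inv, Monoid.CoprodI.lift_of]
    rw [(vertexAct_commute hadj g h).eq]
    group

theorem traceAct_of (x : V) (g : G x) : traceAct Λ G (of Λ G x g) = vertexAct Λ G x g := by
  change Monoid.CoprodI.lift (vertexAct Λ G) (Monoid.CoprodI.of g) = _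
  rw [Monoid.CoprodI.lift_of]

theorem of_commute {x y : V} (h : Λ.Adj x y) (g : G x) (k : G y) :
    Commute (of Λ G x g) (of Λ G y k) := by
  have : (QuotientGroup.mk' (Subgroup.normalClosure (graphProductRelators Λ G)))
      (Monoid.CoprodI.of g * Monoid.CoprodI.of k *
      (Monoid.CoprodI.of g)⁻¹ * (Monoid.CoprodI.of k)⁻¹) = 1 :=
    (QuotientGroup.eq_one_iff _).2 (Subgroup.subset_normalClosure ⟨x, y, g, k, h, rfl⟩)
  simp only [map_mul, map_inv] at this
  exact commutatorElement_eq_one_iff_commute.1 this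

/-! ### Words of syllables and their values -/

/-- The product of a word in the vertex groups. -/
def value (Λ : SimpleGraph V) (w : List (Σ x, G x)) : GraphProduct Λ G :=
  (w.map fun a => of Λ G a.1 a.2).prod

@[simp] theorem value_nil : value Λ ([] : List (Σ x, G x)) = 1 := rfl

@[simp] theorem value_cons (a : Σ x, G x) (w : List (Σ x, G x)) :
    value Λ (a :: w) = of Λ G a.1 a.2 * value Λ w := by simp [value]

@[simp] theorem value_append (w w' : List (Σ x, G x)) :
    value Λ (w ++ w') = value Λ w * value Λ w' := by simp [value]

theorem value_surjective : Function.Surjective (value Λ : List (Σ x, G x) → GraphProduct Λ G) := by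
  intro g
  obtain ⟨c, rfl⟩ := QuotientGroup.mk'_surjective
    (Subgroup.normalClosure (graphProductRelators Λ G)) g
  induction c using Monoid.CoprodI.induction_on with
  | one => exact ⟨[], by simp; rfl⟩
  | of i m => exact ⟨[⟨i, m⟩], by simp; rfl⟩
  | mul x y hx hy =>
    obtain ⟨u, hu⟩ := hx
    obtain ⟨v, hv⟩ := hy
    exact ⟨u ++ v, by rw [value_append, hu, hv, map_mul]; rfl⟩

theorem value_commute {x : V} {g : G x} {w : List (Σ x, G x)} (h : ∀ c ∈ w, Λ.Adj x c.1) :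
    Commute (value Λ w) (of Λ G x g) := by
  induction w with
  | nil => exact Commute.one_left _
  | cons c w ih =>
    rw [value_cons]
    simp only [List.mem_cons, forall_eq_or_imp] at h
    exact (of_commute h.1 g c.2).symm.mul_left (ih h.2)

/-- The trace of a word. -/
noncomputable def trace (Λ : SimpleGraph V) : List (Σ x, G x) → TraceFamily Λ G
  | [] => fun _ => []
  | a :: w => push a (trace Λ w)

/-! ### Normal forms: uniqueness and existence -/

section NormalForm

variable [LinearOrder V]

/-- The letters which may not follow the letter `z`, if the letters in `F` may not replace it. -/
def nextForbidden (Λ : SimpleGraph V) (F : Set V) (z : V) : Set V :=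
  {y | y = z ∨ Λ.Adj y z ∧ (y < z ∨ y ∈ F)}

theorem self_mem_nextForbidden (F : Set V) (z : V) : z ∈ nextForbidden Λ F z := Or.inl rfl

/-- The automaton which accepts the normal forms. Its states are sets of forbidden letters. -/
def nfStep (Λ : SimpleGraph V) (F : Set V) (a : Σ x, G x) (F' : Set V) : Prop :=
  a.1 ∉ F ∧ a.2 ≠ 1 ∧ F' = nextForbidden Λ F a.1

/-- A syllable comes to the front only across letters adjacent to its vertex, and a forbidden vertex
stays forbidden while such letters are read. -/
theorem not_frontedBy_of_run {F F' : Set V} {w : List (Σ x, G x)} (h : Run (nfStep Λ) F w F')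
    {b : Σ x, G x} (hb : b.1 ∈ F) : ¬ FrontedBy b (trace Λ w) := by
  induction w generalizing F with
  | nil => exact not_frontedBy_nil b
  | cons a w ih =>
    obtain ⟨_, ⟨haF, -, rfl⟩, h⟩ := h
    intro hf
    obtain ⟨hadj, hf⟩ := (frontedBy_push_iff fun e => haF (e ▸ hb)).1 hf
    exact ih h (Or.inr ⟨hadj, Or.inr hb⟩) hf

/-- The first letter is forbidden at once in the rest of the word. Hence it meets a trace free of
its vertex, and acting by it is a push without any merging. -/
theorem traceAct_value {F F' : Set V} {w : List (Σ x, G x)} (h : Run (nfStep Λ) F w F') :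
    ∃ hw : Reduced (trace Λ w), traceAct Λ G (value Λ w) ⟨_, Reduced.nil⟩ = ⟨trace Λ w, hw⟩ := by
  induction w generalizing F with
  | nil => exact ⟨Reduced.nil, by simp [trace]⟩
  | cons a w ih =>
    obtain ⟨_, ⟨-, ha, rfl⟩, h⟩ := h
    obtain ⟨hw, he⟩ := ih h
    have hf : Free a.1 (trace Λ w) := fun g =>
      not_frontedBy_of_run h (b := ⟨a.1, g⟩) (self_mem_nextForbidden F a.1)
    refine ⟨.push a _ hw ha hf, ?_⟩
    rw [value_cons, map_mul, Equiv.Perm.mul_apply, he, traceAct_of]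
    have := vertexAct_place hw hf a.2 1
    simp only [place_one, mul_one, place_of_ne ha] at this
    exact this

theorem eq_of_trace_eq {F₁ F₁' F₂ F₂' : Set V} {w w' : List (Σ x, G x)}
    (h : Run (nfStep Λ) F₁ w F₂) (h' : Run (nfStep Λ) F₁' w' F₂') (he : trace Λ w = trace Λ w') :
    w = w' := by
  -- A syllable that can be moved in front of `a` is at a vertex adjacent to that of `a`; were it
  -- smaller, it would be forbidden after `a`. Used in both directions, this makes the first
  -- vertices of two words with equal traces coincide.
  have lt : ∀ {F₁ F₂ : Set V} {a b : Σ x, G x} {t : List (Σ x, G x)} {T : TraceFamily Λ G},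
      Run (nfStep Λ) F₁ (a :: t) F₂ → trace Λ (a :: t) = push b T → a.1 ≠ b.1 → ¬ b.1 < a.1 := by
    rintro F₁ F₂ a b t T ⟨_, ⟨-, -, rfl⟩, h⟩ he hab hlt
    have hf : FrontedBy b (trace Λ (a :: t)) := he ▸ frontedBy_push_self b T
    obtain ⟨hadj, hf⟩ := (frontedBy_push_iff hab.symm).1 hf
    exact not_frontedBy_of_run h (Or.inr ⟨hadj, Or.inl hlt⟩) hf
  induction w generalizing w' F₁ F₁' with
  | nil =>
    cases w' with
    | nil => rfl
    | cons b t =>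
      exact absurd (he.symm ▸ frontedBy_push_self b (trace Λ t) : FrontedBy b (trace Λ []))
        (not_frontedBy_nil b)
  | cons a t ih =>
    cases w' with
    | nil =>
      exact absurd (he ▸ frontedBy_push_self a (trace Λ t) : FrontedBy a (trace Λ []))
        (not_frontedBy_nil a)
    | cons b t' =>
      have hab : a.1 = b.1 := by
        by_contra hab
        exact hab (le_antisymm (not_lt.1 (lt h he hab)) (not_lt.1 (lt h' he.symm (Ne.symm hab))))
      have hf : FrontedBy a (trace Λ (b :: t')) := he ▸ frontedBy_push_self a (trace Λ t)
      obtain rfl := hf.eq (frontedBy_push_self b (trace Λ t')) hab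
      obtain ⟨_, -, h⟩ := h
      obtain ⟨_, -, h'⟩ := h'
      rw [ih h h' (push_injective a he)]

/-- A word is determined by its product if it is in normal form. -/
theorem eq_of_value_eq {F₁ F₁' F₂ F₂' : Set V} {w w' : List (Σ x, G x)}
    (h : Run (nfStep Λ) F₁ w F₂) (h' : Run (nfStep Λ) F₁' w' F₂') (he : value Λ w = value Λ w') :
    w = w' := by
  obtain ⟨hw, e⟩ := traceAct_value h
  obtain ⟨hw', e'⟩ := traceAct_value h'
  rw [he, e'] at e
  exact eq_of_trace_eq h h' (Subtype.ext_iff.1 e).symm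

theorem of_eq_of {x y : V} {g : G x} {h : G y} (hg : g ≠ 1) (hh : h ≠ 1)
    (he : of Λ G x g = of Λ G y h) : (⟨x, g⟩ : Σ x, G x) = ⟨y, h⟩ := by
  have := eq_of_value_eq (Λ := Λ) (w := [⟨x, g⟩]) (w' := [⟨y, h⟩])
    (Run.singleton_iff.2 ⟨Set.notMem_empty _, hg, rfl⟩)
    (Run.singleton_iff.2 ⟨Set.notMem_empty _, hh, rfl⟩) (by simpa using he)
  simpa using this

theorem run_or_exists_defect (F : Set V) (w : List (Σ x, G x)) :
    (∃ F', Run (nfStep Λ) F w F') ∨ ∃ u a v F', w = u ++ a :: v ∧ Run (nfStep Λ) F u F' ∧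
      (a.2 = 1 ∨ a.1 ∈ F') := by
  induction w generalizing F with
  | nil => exact Or.inl ⟨F, rfl⟩
  | cons a w ih =>
    by_cases ha : a.2 = 1 ∨ a.1 ∈ F
    · exact Or.inr ⟨[], a, w, F, rfl, rfl, ha⟩
    · push Not at ha
      have hs : nfStep Λ F a (nextForbidden Λ F a.1) := ⟨ha.2, ha.1, rfl⟩
      rcases ih (nextForbidden Λ F a.1) with ⟨F', h⟩ | ⟨u, b, v, F', rfl, h, hb⟩
      · exact Or.inl ⟨F', _, hs, h⟩
      · exact Or.inr ⟨a :: u, b, v, F', rfl, ⟨_, hs, h⟩, hb⟩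

/-- Starting with nothing forbidden, a forbidden vertex can be traced back to the letter `b` that
caused it. Either `b` is at the same vertex, so the two syllables can be merged, or it is adjacent
and larger, so they are out of order. -/
theorem exists_split_of_mem {u : List (Σ x, G x)} {F : Set V} (h : Run (nfStep Λ) ∅ u F) {x : V}
    (hx : x ∈ F) : ∃ u₁ b u₂, u = u₁ ++ b :: u₂ ∧ (∀ c ∈ u₂, Λ.Adj x c.1) ∧
      (x = b.1 ∨ Λ.Adj x b.1 ∧ x < b.1) := by
  induction u using List.reverseRecOn generalizing F with
  | nil =>
    cases h
    exact absurd hx (Set.notMem_empty x)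
  | append_singleton u b ih =>
    obtain ⟨F₀, hr, -, -, rfl⟩ := Run.concat_iff.1 h
    rcases hx with hx | ⟨hadj, hx | hx⟩
    · exact ⟨u, b, [], rfl, by simp, Or.inl hx⟩
    · exact ⟨u, b, [], rfl, by simp, Or.inr ⟨hadj, hx⟩⟩
    · obtain ⟨u₁, c, u₂, rfl, h₂, hc⟩ := ih hr hx
      refine ⟨u₁, c, u₂ ++ [b], by simp, ?_, hc⟩
      intro d hd
      rcases List.mem_append.1 hd with hd | hd
      · exact h₂ d hd
      · rw [List.mem_singleton.1 hd]
        exact hadj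

/-- Every word has a normal form, which is not longer with respect to any subadditive length on
the vertex groups. -/
theorem exists_normalForm [WellFoundedLT V] (len : ∀ x, G x → ℕ)
    (hlen : ∀ x (a b : G x), len x (a * b) ≤ len x a + len x b) (w : List (Σ x, G x)) :
    ∃ w' F, Run (nfStep Λ) ∅ w' F ∧ value Λ w' = value Λ w ∧
      (w'.map fun a => len a.1 a.2).sum ≤ (w.map fun a => len a.1 a.2).sum := by
  -- Deleting or merging shortens the word, and moving a smaller vertex left lowers it
  -- lexicographically at equal length, so the shortlex order on vertex sequences gives termination.
  -- A merge may create a trivial syllable, which is left to a later deletion.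
  have wf := InvImage.wf (fun w : List (Σ x, G x) => w.map Sigma.fst)
    (List.Shortlex.wf (wellFounded_lt (α := V)))
  induction w using wf.induction with
  | _ w ih =>
    rcases run_or_exists_defect (Λ := Λ) ∅ w with ⟨F, h⟩ | ⟨u, a, v, F, rfl, h, ha | ha⟩
    · exact ⟨w, F, h, rfl, le_rfl⟩
    · obtain ⟨w', F', hr, hv, hl⟩ := ih (u ++ v)
        (List.Shortlex.of_length_lt (by simp))
      refine ⟨w', F', hr, hv.trans (by simp [ha]), hl.trans (by simp)⟩
    · obtain ⟨u₁, b, u₂, rfl, h₂, hb⟩ := exists_split_of_mem h ha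
      have hc := (value_commute (g := a.2) h₂).eq
      rcases hb with hb | ⟨hadj, hlt⟩
      · obtain ⟨x, g⟩ := a
        obtain ⟨y, k⟩ := b
        simp only at hb hc
        subst hb
        obtain ⟨w', F', hr, hv, hl⟩ := ih (u₁ ++ ⟨x, k * g⟩ :: (u₂ ++ v))
          (List.Shortlex.of_length_lt (by simp))
        refine ⟨w', F', hr, hv.trans ?_, hl.trans ?_⟩
        · simp only [value_append, value_cons, map_mul, mul_assoc]
          rw [← mul_assoc (value Λ u₂) (of Λ G x g), hc, mul_assoc]
        · have := hlen x k g
          simp only [List.map_append, List.map_cons, List.sum_append, List.sum_cons]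
          omega
      · obtain ⟨w', F', hr, hv, hl⟩ := ih (u₁ ++ a :: b :: (u₂ ++ v))
          (List.Shortlex.of_lex (by simp; omega) (by
            simp only [List.map_append, List.map_cons, List.append_assoc, List.cons_append]
            exact List.Lex.append_left _ (List.Lex.rel hlt) _))
        refine ⟨w', F', hr, hv.trans ?_, hl.trans ?_⟩
        · have hc' := (of_commute hadj a.2 b.2).eq
          simp only [value_append, value_cons, mul_assoc]
          rw [← mul_assoc (value Λ u₂) (of Λ G a.1 a.2), hc, ← mul_assoc (of Λ G a.1 a.2), hc']
          simp only [mul_assoc]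
        · simp only [List.map_append, List.map_cons, List.sum_append, List.sum_cons]
          omega

end NormalForm

end GraphProduct

/-! ### Recurrence of the normal form automaton -/

namespace GraphProduct

variable {V : Type*} {Λ : SimpleGraph V} {G : V → Type*} [∀ x, Group (G x)]

section Recurrence

variable [LinearOrder V]

variable (Λ G) in
/-- The normal form automaton can go from the state `F₀` to the state `F` by a nonempty word
whose last letter is `x`. -/
def Leads (F₀ : Set V) (x : V) (F : Set V) : Prop :=
  ∃ (F₁ : Set V) (u : List (Σ x, G x)), Run (nfStep Λ) F₀ u F₁ ∧ x ∉ F₁ ∧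
    F = nextForbidden Λ F₁ x

theorem notMem_nextForbidden {F : Set V} {x y : V} (h : Λᶜ.Adj x y) :
    y ∉ nextForbidden Λ F x := by
  rw [SimpleGraph.compl_adj] at h
  rintro (rfl | ⟨hadj, -⟩)
  · exact h.1 rfl
  · exact h.2 hadj.symm

theorem nextForbidden_subset {F U : Set V} (hU : IsLowerSet U) {z : V} (hz : z ∈ U) (hF : F ⊆ U) :
    nextForbidden Λ F z ⊆ U := by
  rintro y (rfl | ⟨-, hy | hy⟩)
  · exact hz
  · exact hU hy.le hz
  · exact hF hy

theorem nextForbidden_empty_of_isBot {m : V} (hm : IsBot m) : nextForbidden Λ ∅ m = {m} := by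
  ext y
  constructor
  · rintro (rfl | ⟨-, hy | hy⟩)
    · rfl
    · exact absurd (hm y) (not_le.2 hy)
    · exact absurd hy (Set.notMem_empty y)
  · rintro rfl
    exact self_mem_nextForbidden _ _

/-- What `p` forbids is at most `p`, hence below `z`, and `z` itself forbids its smaller neighbours
again. -/
theorem nextForbidden_nextForbidden_empty {z p : V} (hp : p < z) :
    nextForbidden Λ (nextForbidden Λ ∅ p) z = nextForbidden Λ ∅ z := by
  ext y
  constructor
  · rintro (rfl | ⟨hadj, hy | hy⟩)
    · exact self_mem_nextForbidden _ _
    · exact Or.inr ⟨hadj, Or.inl hy⟩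
    · refine Or.inr ⟨hadj, Or.inl ?_⟩
      rcases hy with rfl | ⟨-, hy | hy⟩
      · exact hp
      · exact hy.trans hp
      · exact absurd hy (Set.notMem_empty y)
  · rintro (rfl | ⟨hadj, hy | hy⟩)
    · exact self_mem_nextForbidden _ _
    · exact Or.inr ⟨hadj, Or.inl hy⟩
    · exact absurd hy (Set.notMem_empty y)

variable [∀ x, Nontrivial (G x)]

theorem Leads.step {F₀ F : Set V} {x y : V} (h : Leads Λ G F₀ x F) (hxy : Λᶜ.Adj x y) :
    Leads Λ G F₀ y (nextForbidden Λ F y) := by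
  obtain ⟨F₁, u, hu, hx, rfl⟩ := h
  obtain ⟨g, hg⟩ := exists_ne (1 : G x)
  exact ⟨_, u ++ [⟨x, g⟩], Run.concat_iff.2 ⟨F₁, hu, hx, hg, rfl⟩, notMem_nextForbidden hxy, rfl⟩

variable [Finite V] {m : V}

/-- Descend through smaller non-neighbours. Each letter read lies below the previous one, so no
forbidden vertex outside the lower set `U` is created. -/
theorem Leads.down (hpar : ∀ z, z ≠ m → ∃ p < z, Λᶜ.Adj z p)
    {F₀ F : Set V} {z : V} (h : Leads Λ G F₀ z F) {U : Set V} (hU : IsLowerSet U)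
    (hF : F ⊆ U) : ∃ F', Leads Λ G F₀ m F' ∧ F' ⊆ U := by
  induction z using WellFoundedLT.induction generalizing F with
  | ind z ih =>
    by_cases hz : z = m
    · exact ⟨F, hz ▸ h, hF⟩
    · obtain ⟨p, hp, hadj⟩ := hpar z hz
      refine ih p hp (h.step hadj) (nextForbidden_subset hU (hU hp.le (hF ?_)) hF)
      obtain ⟨_, _, _, _, rfl⟩ := h
      exact self_mem_nextForbidden _ _

/-- The descent from `z` to `m` is read backwards; all its vertices lie in `U`. -/
theorem Leads.up (hpar : ∀ z, z ≠ m → ∃ p < z, Λᶜ.Adj z p)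
    {F₀ F : Set V} {z : V} (h : Leads Λ G F₀ m F) {U : Set V} (hU : IsLowerSet U)
    (hF : F ⊆ U) (hz : z ∈ U) : ∃ F', Leads Λ G F₀ z F' ∧ F' ⊆ U := by
  induction z using WellFoundedLT.induction with
  | ind z ih =>
    by_cases hzm : z = m
    · exact ⟨F, hzm ▸ h, hF⟩
    · obtain ⟨p, hp, hadj⟩ := hpar z hzm
      obtain ⟨F', h', hF'⟩ := ih p hp (hU hp.le hz)
      exact ⟨_, h'.step hadj.symm, nextForbidden_subset hU hz hF'⟩

/-- Climb from `m` to the bound `j` and step to a smaller non-neighbour `p`. This makes `j` allowed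
and forbids nothing new from `j` upwards. After returning to `m` the bound has dropped. -/
theorem Leads.clear (hm : IsBot m)
    (hpar : ∀ z, z ≠ m → ∃ p < z, Λᶜ.Adj z p)
    {F₀ F : Set V} {j : V} (h : Leads Λ G F₀ m F) (hF : F ⊆ Set.Iic j) :
    Leads Λ G F₀ m {m} := by
  induction j using WellFoundedLT.induction generalizing F with
  | ind j ih =>
    have hmem : ∀ {F}, Leads Λ G F₀ m F → m ∈ F := by
      rintro _ ⟨_, _, _, _, rfl⟩
      exact self_mem_nextForbidden _ _
    by_cases hj : j = m
    · have : F = {m} := Set.Subset.antisymm (fun y hy => le_antisymm (hj ▸ hF hy) (hm y))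
        (Set.singleton_subset_iff.2 (hmem h))
      exact this ▸ h
    · obtain ⟨p, hp, hadj⟩ := hpar j hj
      obtain ⟨F', h', hF'⟩ := h.up hpar (isLowerSet_Iic j) hF (Set.mem_Iic.2 le_rfl)
      have hsub : nextForbidden Λ F' p ⊆ Set.Iio j := by
        intro y hy
        refine lt_of_le_of_ne
          (nextForbidden_subset (isLowerSet_Iic j) (Set.mem_Iic.2 hp.le) hF' hy) ?_
        rintro rfl
        exact notMem_nextForbidden hadj.symm hy
      obtain ⟨F'', h'', hF''⟩ := (h'.step hadj).down hpar (isLowerSet_Iio j) hsub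
      obtain ⟨k, hk, hmax⟩ := Set.exists_max_image F'' id (Set.toFinite _) ⟨m, hmem h''⟩
      exact ih k (hF'' hk) h'' hmax

theorem leads_nextForbidden_empty (hm : IsBot m)
    (hpar : ∀ z, z ≠ m → ∃ p < z, Λᶜ.Adj z p)
    [Nontrivial V] (hΛ : Λᶜ.Connected) (A : Set V) (x z : V) :
    Leads Λ G (nextForbidden Λ A x) z (nextForbidden Λ ∅ z) := by
  -- A first letter is available in any such state: a non-neighbour of the last vertex `x` is never
  -- forbidden.
  obtain ⟨c, hc⟩ := hΛ.preconnected.exists_adj_of_nontrivial x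
  have h₀ : Leads Λ G (nextForbidden Λ A x) c (nextForbidden Λ (nextForbidden Λ A x) c) :=
    ⟨_, [], rfl, notMem_nextForbidden hc, rfl⟩
  obtain ⟨F, h₁, -⟩ := h₀.down hpar isLowerSet_univ (Set.subset_univ _)
  obtain ⟨k, -, hmax⟩ := Set.exists_max_image F id (Set.toFinite _) (by
    obtain ⟨_, _, _, _, rfl⟩ := h₁
    exact ⟨m, self_mem_nextForbidden _ _⟩)
  have h₂ := h₁.clear hm hpar (j := k) hmax
  induction z using WellFoundedLT.induction with
  | ind z ih =>
    by_cases hz : z = m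
    · rw [hz, nextForbidden_empty_of_isBot hm]
      exact h₂
    · obtain ⟨p, hp, hadj⟩ := hpar z hz
      rw [← nextForbidden_nextForbidden_empty hp]
      exact (ih p hp).step hadj.symm

/-- The prefix `u` is chosen so that the first letter of `w` leads to the state it would have
produced from `∅`. The word must be nonempty because `∅` itself is never reached again. -/
theorem exists_run_append (hm : IsBot m)
    (hpar : ∀ z, z ≠ m → ∃ p < z, Λᶜ.Adj z p)
    [Nontrivial V] (hΛ : Λᶜ.Connected) (A : Set V) (x : V) {F : Set V}
    {w : List (Σ x, G x)} (hw : w ≠ []) (h : Run (nfStep Λ) ∅ w F) :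
    ∃ u, Run (nfStep Λ) (nextForbidden Λ A x) (u ++ w) F := by
  obtain ⟨a, w, rfl⟩ := List.exists_cons_of_ne_nil hw
  obtain ⟨_, ⟨-, ha, rfl⟩, h⟩ := h
  obtain ⟨F₁, u, hu, hF₁, he⟩ := leads_nextForbidden_empty (G := G) hm hpar hΛ A x a.1
  exact ⟨u, hu.trans ⟨_, ⟨hF₁, ha, he⟩, h⟩⟩

end Recurrence

end GraphProduct

/-! ### The combing automaton of the graph product -/

namespace GraphProduct

variable {V : Type*} {Λ : SimpleGraph V} {G : V → Type*}

section Combing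

variable [LinearOrder V] {Γ : ∀ x, GraphStructure (G x)}

/-- The states of the automaton accepting the geodesic normal forms of a graph product: the initial
state, and the states given by a state of the automaton of the current vertex group together with
the set of forbidden vertices. -/
abbrev CombState (Γ : ∀ x, GraphStructure (G x)) : Type _ :=
  Option ((Σ x, (Γ x).Vert) × Set V)

/-- The vertices at which no new syllable may start. -/
def forbidden : CombState Γ → Set V
  | none => ∅
  | some (a, F) => insert a.1 F

/-- In the states that occur in runs from `none`, the current vertex is already forbidden. Inserting
it in `forbidden` serves determinism, which is required of unreachable states as well. -/
theorem forbidden_some_nextForbidden {x : V} {v : (Γ x).Vert} {F : Set V} :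
    forbidden (some (⟨x, v⟩, nextForbidden Λ F x) : CombState Γ) = nextForbidden Λ F x :=
  Set.insert_eq_of_mem (self_mem_nextForbidden F x)

variable [∀ x, Group (G x)] {S : ∀ x, Set (G x)}

/-- The transitions continue the current syllable or start a new one. -/
inductive CombStep (Λ : SimpleGraph V) (Γ : ∀ x, GraphStructure (G x)) :
    CombState Γ → GraphProduct Λ G → CombState Γ → Prop
  | cont (x : V) (v : (Γ x).Vert) (s : G x) (v' : (Γ x).Vert) (F : Set V) :
      (Γ x).Step v s v' → CombStep Λ Γ (some (⟨x, v⟩, F)) (of Λ G x s) (some (⟨x, v'⟩, F))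
  | start (q : CombState Γ) (x : V) (s : G x) (v' : (Γ x).Vert) :
      x ∉ forbidden q → (Γ x).Step (Γ x).init s v' →
        CombStep Λ Γ q (of Λ G x s) (some (⟨x, v'⟩, nextForbidden Λ (forbidden q) x))

/-- The set of generators of a graph product given by generators of the vertex groups. -/
abbrev generators (Λ : SimpleGraph V) (S : ∀ x, Set (G x)) : Set (GraphProduct Λ G) :=
  ⋃ x, of Λ G x '' S x

/-- The total length of a word in the vertex groups. -/
noncomputable def totalLength (S : ∀ x, Set (G x)) (w : List (Σ x, G x)) : ℕ :=
  (w.map fun a => wordLength (S a.1) a.2).sum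

/-- The word of group elements `l` spells the normal form `w` followed by a syllable at the vertex
`x` which is spelled by `lx`. -/
structure Spells (Λ : SimpleGraph V) (Γ : ∀ x, GraphStructure (G x)) (S : ∀ x, Set (G x))
    (l : List (GraphProduct Λ G)) (w : List (Σ x, G x)) (F : Set V) (x : V) (v : (Γ x).Vert)
    (lx : List (G x)) : Prop where
  run : Run (nfStep Λ) ∅ w F
  notMem : x ∉ F
  ne_nil : lx ≠ []
  runSyllable : Run (Γ x).Step (Γ x).init lx v
  prod_eq : l.prod = value Λ (w ++ [⟨x, lx.prod⟩])
  suffix : lx.map (of Λ G x) <:+ l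
  length_eq : l.length = totalLength S w + lx.length

theorem exists_run_syllable {q : CombState Γ} {x : V} (hx : x ∉ forbidden q) {v : (Γ x).Vert}
    {lx : List (G x)} (hl : Run (Γ x).Step (Γ x).init lx v) (hne : lx ≠ []) :
    Run (CombStep Λ Γ) q (lx.map (of Λ G x)) (some (⟨x, v⟩, nextForbidden Λ (forbidden q) x)) := by
  obtain ⟨s, l, rfl⟩ := List.exists_cons_of_ne_nil hne
  obtain ⟨u, hs, hl⟩ := hl
  refine ⟨_, .start q x s u hx hs, ?_⟩
  clear hne hs
  induction l generalizing u with
  | nil => cases hl; rfl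
  | cons t l ih =>
    obtain ⟨u', ht, hl⟩ := hl
    exact ⟨_, .cont x u t u' _ ht, ih _ hl⟩

theorem Spells.run_append (hΓ : ∀ x, (Γ x).IsGeodesicCombing (S x))
    {l : List (GraphProduct Λ G)} {w : List (Σ x, G x)} {F : Set V} {x : V}
    {v : (Γ x).Vert} {lx : List (G x)} (h : Spells Λ Γ S l w F x v lx) :
    Run (nfStep Λ) ∅ (w ++ [⟨x, lx.prod⟩]) (nextForbidden Λ F x) :=
  Run.concat_iff.2 ⟨F, h.run, h.notMem, (hΓ x).prod_ne_one h.runSyllable h.ne_nil, rfl⟩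

theorem Spells.totalLength_append (hΓ : ∀ x, (Γ x).IsGeodesicCombing (S x))
    {l : List (GraphProduct Λ G)} {w : List (Σ x, G x)} {F : Set V}
    {x : V} {v : (Γ x).Vert} {lx : List (G x)} (h : Spells Λ Γ S l w F x v lx) :
    totalLength S (w ++ [⟨x, lx.prod⟩]) = l.length := by
  rw [h.length_eq, ← (hΓ x).run_length h.runSyllable]
  simp [totalLength]

/-- The last syllable is kept apart from `w` because it may still grow; `F` is the normal form state
before it. -/
theorem exists_spells (hΓ : ∀ x, (Γ x).IsGeodesicCombing (S x))
    {l : List (GraphProduct Λ G)} {q : CombState Γ}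
    (h : Run (CombStep Λ Γ) none l q) : (l = [] ∧ q = none) ∨
      ∃ w F x v lx, Spells Λ Γ S l w F x v lx ∧ q = some (⟨x, v⟩, nextForbidden Λ F x) := by
  induction l using List.reverseRecOn generalizing q with
  | nil => exact Or.inl ⟨rfl, h.symm⟩
  | append_singleton l a ih =>
    right
    obtain ⟨r, hr, ha⟩ := Run.concat_iff.1 h
    rcases ih hr with ⟨rfl, rfl⟩ | ⟨w, F, x, v, lx, hl, rfl⟩
    · cases ha with
      | start q x s v' hx hs =>
        exact ⟨[], ∅, x, v', [s], ⟨rfl, hx, by simp, Run.singleton_iff.2 hs, by simp,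
          by simp, by simp [totalLength]⟩, rfl⟩
    · cases ha with
      | cont x v s v' F' hs =>
        refine ⟨w, F, x, v', lx ++ [s], ⟨hl.run, hl.notMem, by simp,
          Run.concat_iff.2 ⟨v, hl.runSyllable, hs⟩, ?_, ?_, ?_⟩, rfl⟩
        · simp [hl.prod_eq, mul_assoc]
        · obtain ⟨l₀, hl₀⟩ := hl.suffix
          exact ⟨l₀, by simp [← hl₀]⟩
        · simp [hl.length_eq, add_assoc]
      | start q y s v' hy hs =>
        rw [forbidden_some_nextForbidden] at hy
        refine ⟨w ++ [⟨x, lx.prod⟩], _, y, v', [s], ⟨hl.run_append hΓ, hy, by simp,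
          Run.singleton_iff.2 hs, ?_, ?_, ?_⟩, ?_⟩
        · simp [hl.prod_eq, mul_assoc]
        · exact ⟨l, by simp⟩
        · simp [hl.totalLength_append hΓ]
        · rw [forbidden_some_nextForbidden]

theorem combStep_mem (hΓ : ∀ x, (Γ x).IsGeodesicCombing (S x))
    {q r : CombState Γ} {a : GraphProduct Λ G} (h : CombStep Λ Γ q a r) :
    a ∈ generators Λ S := by
  cases h with
  | cont x v s v' F hs => exact Set.mem_iUnion.2 ⟨x, s, (hΓ x).step_mem hs, rfl⟩
  | start q x s v' hx hs => exact Set.mem_iUnion.2 ⟨x, s, (hΓ x).step_mem hs, rfl⟩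

/-- Nontrivial elements of vertex groups stay distinct in the graph product, so a label determines
its vertex and element. It cannot both continue and start a syllable, the current vertex being
forbidden. The labels are kept as two variables with an equation so that both steps can be
destructured. -/
theorem combStep_unique (hΓ : ∀ x, (Γ x).IsGeodesicCombing (S x))
    {q r r' : CombState Γ} {a a' : GraphProduct Λ G} (h : CombStep Λ Γ q a r)
    (h' : CombStep Λ Γ q a' r') (he : a = a') : r = r' := by
  have inj : ∀ {x y : V} {s : G x} {t : G y} {v v' : (Γ x).Vert} {u u' : (Γ y).Vert},
      (Γ x).Step v s v' → (Γ y).Step u t u' → of Λ G x s = of Λ G y t →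
        (⟨x, s⟩ : Σ x, G x) = ⟨y, t⟩ := fun hs ht he =>
    of_eq_of ((hΓ _).ne_one_of_mem ((hΓ _).step_mem hs))
      ((hΓ _).ne_one_of_mem ((hΓ _).step_mem ht)) he
  cases h with
  | cont x v s v' F hs =>
    cases h' with
    | cont x v t u' F ht =>
      obtain rfl : s = t := by simpa using inj hs ht he
      rw [hs.unique ht]
    | start q y t u' hy ht =>
      obtain rfl : x = y := congrArg Sigma.fst (inj hs ht he)
      exact absurd (Set.mem_insert _ _) hy
  | start q x s v' hx hs =>
    cases h' with
    | cont y v t u' F ht =>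
      obtain rfl : x = y := congrArg Sigma.fst (inj hs ht he)
      exact absurd (Set.mem_insert _ _) hx
    | start q y t u' hy ht =>
      have := inj hs ht he
      cases this
      rw [hs.unique ht]

theorem exists_normalForm_of_run (hΓ : ∀ x, (Γ x).IsGeodesicCombing (S x))
    {l : List (GraphProduct Λ G)} {q : CombState Γ}
    (h : Run (CombStep Λ Γ) none l q) : ∃ w F, Run (nfStep Λ) ∅ w F ∧ value Λ w = l.prod ∧
      totalLength S w = l.length := by
  rcases exists_spells hΓ h with ⟨rfl, rfl⟩ | ⟨w, F, x, v, lx, hl, rfl⟩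
  · exact ⟨[], ∅, rfl, rfl, rfl⟩
  · exact ⟨_, _, hl.run_append hΓ, hl.prod_eq.symm, hl.totalLength_append hΓ⟩

/-- Equal values give equal normal forms, so the last syllables agree and are spelled alike. Hence
the last letters agree and can be cancelled. -/
theorem combRun_unique (hΓ : ∀ x, (Γ x).IsGeodesicCombing (S x))
    {l l' : List (GraphProduct Λ G)} {q q' : CombState Γ}
    (h : Run (CombStep Λ Γ) none l q) (h' : Run (CombStep Λ Γ) none l' q')
    (he : l.prod = l'.prod) : l = l' := by
  induction l using List.reverseRecOn generalizing l' q q' with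
  | nil =>
    obtain ⟨w, F, hw, hv, hlen⟩ := exists_normalForm_of_run hΓ h'
    obtain rfl : w = [] := eq_of_value_eq hw (w' := []) (F₁' := ∅) rfl (hv.trans he.symm)
    exact (List.length_eq_zero_iff.1 hlen.symm).symm
  | append_singleton l a ih =>
    rcases exists_spells hΓ h with ⟨h₀, -⟩ | ⟨w, F, x, v, lx, hl, -⟩
    · simp at h₀
    rcases exists_spells hΓ h' with ⟨rfl, -⟩ | ⟨w', F', x', v', lx', hl', -⟩
    · have := eq_of_value_eq (hl.run_append hΓ) (w' := []) (F₁' := ∅) (F₂' := ∅) rfl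
        (hl.prod_eq.symm.trans he)
      simp at this
    have hw := eq_of_value_eq (hl.run_append hΓ) (hl'.run_append hΓ)
      (hl.prod_eq.symm.trans (he.trans hl'.prod_eq))
    have hs : (⟨x, lx.prod⟩ : Σ x, G x) = ⟨x', lx'.prod⟩ := by
      simpa using (List.append_inj' hw rfl).2
    obtain rfl : x = x' := congrArg Sigma.fst hs
    obtain rfl : lx = lx' :=
      (hΓ x).run_unique hl.runSyllable hl'.runSyllable (by simpa using hs)
    obtain ⟨k, s, rfl⟩ := (List.eq_nil_or_concat lx).resolve_left hl.ne_nil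
    obtain ⟨l₀, hl₀⟩ := hl.suffix
    obtain ⟨l₀', rfl⟩ := hl'.suffix
    simp only [List.concat_eq_append, List.map_append, List.map_cons, List.map_nil,
      ← List.append_assoc] at hl₀ he h' ⊢
    obtain ⟨h₁, h₂⟩ := List.append_inj' hl₀ rfl
    obtain rfl : of Λ G x s = a := by simpa using h₂
    obtain ⟨_, hr, -⟩ := Run.concat_iff.1 h
    obtain ⟨_, hr', -⟩ := Run.concat_iff.1 h'
    rw [List.prod_append, List.prod_append (l₂ := [_])] at he
    rw [ih hr hr' (mul_right_cancel he)]

theorem exists_combRun (hΓ : ∀ x, (Γ x).IsGeodesicCombing (S x))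
    {q : CombState Γ} {F : Set V} {w : List (Σ x, G x)}
    (h : Run (nfStep Λ) (forbidden q) w F) :
    ∃ l q', Run (CombStep Λ Γ) q l q' ∧ l.prod = value Λ w ∧ forbidden q' = F := by
  induction w generalizing q with
  | nil => exact ⟨[], q, rfl, rfl, h⟩
  | cons a w ih =>
    obtain ⟨_, ⟨hx, ha, rfl⟩, h⟩ := h
    obtain ⟨x, g⟩ := a
    obtain ⟨lx, v, hlx, rfl⟩ := (hΓ x).exists_run g
    simp only at hx ha h
    have hr := exists_run_syllable (Λ := Λ) hx hlx (fun e => ha (by rw [e, List.prod_nil]))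
    rw [← forbidden_some_nextForbidden (Γ := Γ) (v := v)] at h
    obtain ⟨l, q', hl, hv, hF⟩ := ih h
    exact ⟨_, q', hr.trans hl, by simp [hv, map_list_prod], hF⟩

theorem wordLength_combRun (hΓ : ∀ x, (Γ x).IsGeodesicCombing (S x))
    [WellFoundedLT V] {l : List (GraphProduct Λ G)} {q : CombState Γ}
    (h : Run (CombStep Λ Γ) none l q) : wordLength (generators Λ S) l.prod = l.length := by
  have hmem : ∀ s ∈ l, s ∈ generators Λ S ∨ s⁻¹ ∈ generators Λ S := fun s hs =>
    Or.inl (h.mem (P := (· ∈ generators Λ S)) (fun _ _ _ => combStep_mem hΓ) s hs)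
  refine le_antisymm (wordLength_le hmem) ?_
  obtain ⟨l', hl', hp, hlen⟩ := exists_list_of_wordLength hmem
  rw [← hlen]
  -- Read each letter of the shortest word, possibly an inverse generator, as one syllable of length
  -- at most 1.
  have : ∃ w : List (Σ x, G x), value Λ w = l'.prod ∧ totalLength S w ≤ l'.length := by
    clear hp hlen
    induction l' with
    | nil => exact ⟨[], rfl, le_rfl⟩
    | cons a l' ih =>
      obtain ⟨w, hw, hwl⟩ := ih fun s hs => hl' s (List.mem_cons_of_mem a hs)
      have : ∃ (x : V) (g : G x), (g ∈ S x ∨ g⁻¹ ∈ S x) ∧ of Λ G x g = a := by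
        rcases hl' a List.mem_cons_self with ha | ha
        · obtain ⟨x, g, hg, rfl⟩ := Set.mem_iUnion.1 ha
          exact ⟨x, g, Or.inl hg, rfl⟩
        · obtain ⟨x, g, hg, hga⟩ := Set.mem_iUnion.1 ha
          exact ⟨x, g⁻¹, Or.inr (by rwa [inv_inv]), by rw [map_inv, hga, inv_inv]⟩
      obtain ⟨x, g, hg, rfl⟩ := this
      refine ⟨⟨x, g⟩ :: w, by simp [hw], ?_⟩
      have := wordLength_le_one hg
      simp only [totalLength, List.map_cons, List.sum_cons, List.length_cons] at hwl ⊢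
      omega
  obtain ⟨w, hw, hwl⟩ := this
  obtain ⟨w', F', hr', hv', hl'⟩ := exists_normalForm (Λ := Λ) (fun x => wordLength (S x))
    (fun x => (hΓ x).wordLength_mul_le) w
  obtain ⟨w₀, F₀, hr₀, hv₀, hl₀⟩ := exists_normalForm_of_run hΓ h
  obtain rfl := eq_of_value_eq hr' hr₀ (hv'.trans (hw.trans (hp.trans hv₀.symm)))
  rw [← hl₀]
  exact hl'.trans hwl

theorem exists_run_of_ne_none (hΓ : ∀ x, (Γ x).IsGeodesicCombing (S x))
    [Finite V] [Nontrivial V] [∀ x, Nontrivial (G x)] {m : V}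
    (hm : IsBot m) (hpar : ∀ z, z ≠ m → ∃ p < z, Λᶜ.Adj z p) (hΛ : Λᶜ.Connected)
    {l l' : List (GraphProduct Λ G)} {q q' : CombState Γ}
    (h : Run (CombStep Λ Γ) none l q) (h' : Run (CombStep Λ Γ) none l' q') (hq' : q' ≠ none) :
    ∃ k, Run (CombStep Λ Γ) q k q' := by
  rcases exists_spells hΓ h with ⟨rfl, rfl⟩ | ⟨w, F, x, v, lx, hl, rfl⟩
  · exact ⟨l', h'⟩
  rcases exists_spells hΓ h' with ⟨rfl, rfl⟩ | ⟨w', F', x', v', lx', hl', rfl⟩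
  · exact absurd rfl hq'
  obtain ⟨u, hu⟩ := exists_run_append hm hpar hΛ F x (by simp) (hl'.run_append hΓ)
  rw [← List.append_assoc, ← forbidden_some_nextForbidden (Γ := Γ) (v := v)] at hu
  -- The last syllable is split off and spelled by `lx'` itself: `exists_combRun` controls only the
  -- forbidden set, while the target also prescribes the vertex `v'` of the local combing.
  obtain ⟨F₁, hu, hx', -, he⟩ := Run.concat_iff.1 hu
  obtain ⟨k, r, hk, -, rfl⟩ := exists_combRun hΓ hu
  have hr := exists_run_syllable (Λ := Λ) hx' hl'.runSyllable hl'.ne_nil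
  rw [← he] at hr
  exact ⟨_, hk.trans hr⟩

end Combing

/-- Order by distance from a root `m`, breaking ties by an arbitrary numbering. The next vertex on a
shortest walk to `m` is strictly closer, hence smaller. -/
theorem exists_linearOrder {V : Type*} [Finite V] {H : SimpleGraph V} (hH : H.Connected) :
    ∃ (_ : LinearOrder V) (m : V), IsBot m ∧ ∀ z, z ≠ m → ∃ p < z, H.Adj z p := by
  obtain ⟨m⟩ := hH.nonempty
  obtain ⟨n, ⟨e⟩⟩ := Finite.exists_equiv_fin V
  let f : V → ℕ ×ₗ Fin n := fun z => toLex (H.dist m z, e z)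
  have hf : Function.Injective f := fun a b h => e.injective (Prod.ext_iff.1 (toLex.injective h)).2
  have hlt : ∀ a b, H.dist m a < H.dist m b → f a < f b := fun a b h =>
    Prod.Lex.toLex_lt_toLex.2 (Or.inl h)
  refine ⟨LinearOrder.lift' f hf, m, fun z => ?_, fun z hz => ?_⟩
  · by_cases hz : m = z
    · subst hz
      exact le_refl (f m)
    · refine (hlt m z ?_).le
      rw [SimpleGraph.dist_self]
      exact hH.pos_dist_of_ne hz
  · obtain ⟨p, hp⟩ := hH.exists_walk_length_eq_dist z m
    cases p with
    | nil => exact absurd rfl hz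
    | cons hadj p =>
      refine ⟨_, hlt _ _ ?_, hadj⟩
      rw [H.dist_comm, H.dist_comm (u := m) (v := z), ← hp, SimpleGraph.Walk.length_cons]
      exact Nat.lt_succ_of_le (SimpleGraph.dist_le p)

end GraphProduct

theorem proposition10 {V : Type*} [Finite V] [Nontrivial V] (Λ : SimpleGraph V)
    (hΛ : Λᶜ.Connected) (G : V → Type*) [∀ x, Group (G x)] [∀ x, Nontrivial (G x)]
    (S : ∀ x, Set (G x)) (Γ : ∀ x, GraphStructure (G x))
    (hΓ : ∀ x, (Γ x).IsGeodesicCombing (S x)) :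
    ∃ Δ : GraphStructure (GraphProduct Λ G),
      Δ.IsGeodesicCombing (⋃ x, GraphProduct.of Λ G x '' S x) ∧ Δ.IsRecurrent := by
  obtain ⟨_, m, hm, hpar⟩ := GraphProduct.exists_linearOrder hΛ
  have (x : V) : Finite (Γ x).Vert := (Γ x).finite_vert
  refine GraphStructure.exists_combing_of_automaton (δ := GraphProduct.CombStep Λ Γ) (q₀ := none)
    (Set.finite_iUnion fun x => (hΓ x).finite.image _)
    (fun q s r r' h h' => GraphProduct.combStep_unique hΓ h h' rfl)
    (fun q s r => GraphProduct.combStep_mem hΓ) ?_ ?_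
    (fun l l' q q' => GraphProduct.combRun_unique hΓ)
    (fun l q => GraphProduct.wordLength_combRun hΓ) ?_
  · intro s hs
    obtain ⟨x, s, hsx, rfl⟩ := Set.mem_iUnion.1 hs
    obtain ⟨v, hv⟩ := (hΓ x).exists_step_of_mem hsx
    exact ⟨_, .start none x s v (Set.notMem_empty x) hv⟩
  · intro g
    obtain ⟨w, rfl⟩ := GraphProduct.value_surjective g
    -- Only the existence of a normal form matters here, so the zero length function suffices.
    obtain ⟨w', F, hr, hv, -⟩ := GraphProduct.exists_normalForm (Λ := Λ) (fun _ _ => 0) (by simp) w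
    obtain ⟨l, q, hl, hp, -⟩ := GraphProduct.exists_combRun hΓ (q := none) hr
    exact ⟨l, q, hl, hp.trans hv⟩
  · rintro q q' ⟨l, hl⟩ ⟨l', hl'⟩ hq'
    exact GraphProduct.exists_run_of_ne_none hΓ hm hpar hΛ hl hl' hq'
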